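/- A clutter $\mathcal C$ on a finite vertex set $V$ is a family of subsets of $V$ (circuits), none of which is contained in another one. A set $\sigma\subseteq V$ is independent if it contains no circuit, and $I(\mathcal C)$ is the simplicial complex of all independent sets. For $v\in V$, the contraction $\mathcal C/v$ is the clutter on $V\setminus\{v\}$ whose circuits are the minimal sets among the $e\setminus\{v\}$, $e$ a circuit of $\mathcal C$; a contraction of $\mathcal C$ is a clutter obtained from $\mathcal C$ by repeatedly (possibly zero times) contracting vertices. A vertex $v$ is simplicial if for every two distinct circuits $e_1,e_2$ containing $v$ there is a circuit $e_3\subseteq(e_1\cup e_2)\setminus\{v\}$. A face $\sigma$ of a complex $\Delta$ is a shedding face if for every face $\tau\supseteq\sigma$ and every $v\in\sigma$ there is a vertex $w\notin\tau$ such that $(\tau\cup\{w\})\setminus\{v\}$ is a face. For an integer $j$, $\Delta$ is recursively defined to be $j$-decomposable if it is a simplex (possibly $\{\emptyset\}$) or has no faces, or if it has a shedding face $\sigma$ with $\dim\sigma\le j$ such that both $\Delta\setminus\sigma=\{\tau\in\Delta:\sigma\not\subseteq\tau\}$ and $\operatorname{link}_\Delta\sigma$ are $j$-decomposable. $\Delta$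 is shellable if its facets can be ordered $\sigma_1,\dots,\sigma_m$ so that for each $i\ge2$ the intersection of $\sigma_i$ with the complex generated by $\sigma_1,\dots,\sigma_{i-1}$ is pure of dimension $\dim\sigma_i-1$. $\Delta$ is Cohen–Macaulay over $R$ if $\tilde H_i(\operatorname{link}_\Delta\sigma;R)=0$ for every face $\sigma$ (including $\emptyset$) and every $i<\dim\operatorname{link}_\Delta\sigma$, and sequentially Cohen–Macaulay over $R$ if for every $d$ the subcomplex generated by its $d$-dimensional faces is Cohen–Macaulay over $R$. **Statement.** Let $\mathcal C$ be a clutter with maximum circuit cardinality $k$ ($k=0$ if there are no circuits). Suppose that every contraction of $\mathcal C$ has, up to singleton circuits, a simplicial vertex; that is, for every contraction $\mathcal D$ of $\mathcal C$ having at least one vertex $x$ with $\{x\}$ independent in $\mathcal D$, there is a simplicial vertex $v$ of $\mathcal D$ with $\{v\}$ independent in $\mathcal D$. Then $I(\mathcal C)$ is $(k-2)$-decomposable, it is shellable, and it is sequentially Cohen–Macaulay over every field and over $\mathbb Z$. -/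

import Mathlib

universe u w

/-- A finite abstract simplicial complex: a finite family of finite sets, closed under passing to
subsets. The void complex `{}` and the complex `{∅}` are both allowed, and a point of `α` need not
span a face. The ambient vertex set is not recorded, since no notion below depends on it. -/
@[ext]
structure FinComplex (α : Type u) where
  faces : Finset (Finset α)
  down_closed : ∀ s ∈ faces, ∀ t, t ⊆ s → t ∈ faces

/-- A clutter on a finite vertex set: a family of subsets (circuits), none of which is contained
in another one. -/
@[ext]
structure Clutter (α : Type u) where
  verts : Finset α
  circuits : Finset (Finset α)
  circuit_subset : ∀ e ∈ circuits, e ⊆ verts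
  antichain : ∀ e₁ ∈ circuits, ∀ e₂ ∈ circuits, e₁ ⊆ e₂ → e₁ = e₂

namespace FinComplex

variable {α : Type u}

/-- The dimension of a face: its cardinality minus one. -/
def faceDim (s : Finset α) : ℤ := (s.card : ℤ) - 1

/-- The dimension of a complex with at least one face: the largest dimension of a face. -/
def dim (K : FinComplex α) : ℤ := (K.faces.sup Finset.card : ℕ) - 1

/-- A facet is a face that is maximal under inclusion. -/
def IsFacet (K : FinComplex α) (s : Finset α) : Prop :=
  s ∈ K.faces ∧ ∀ t ∈ K.faces, s ⊆ t → t = s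

/-- `K` is pure of dimension `d`: it has a face, and all its facets have dimension `d`. -/
def IsPureOfDim (K : FinComplex α) (d : ℤ) : Prop :=
  K.faces.Nonempty ∧ ∀ s, K.IsFacet s → faceDim s = d

/-- The complex `{}` with no face at all. -/
def void : FinComplex α where
  faces := ∅
  down_closed := by simp

variable [DecidableEq α]

/-- The complex generated by a family of sets: all subsets of its members. -/
def generatedBy (S : Finset (Finset α)) : FinComplex α where
  faces := S.biUnion Finset.powerset
  down_closed := by
    intro s hs t hts
    simp only [Finset.mem_biUnion, Finset.mem_powerset] at hs ⊢
    obtain ⟨a, ha, hsa⟩ := hs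
    exact ⟨a, ha, hts.trans hsa⟩

/-- The simplex on the vertex set `s`: all subsets of `s`. For `s = ∅` this is `{∅}`. -/
def simplex (s : Finset α) : FinComplex α := generatedBy {s}

/-- The intersection of two complexes. -/
def inter (K L : FinComplex α) : FinComplex α where
  faces := K.faces ∩ L.faces
  down_closed := by
    intro s hs t hts
    rw [Finset.mem_inter] at hs ⊢
    exact ⟨K.down_closed s hs.1 t hts, L.down_closed s hs.2 t hts⟩

/-- `K \ σ`: remove all faces that contain `σ`. -/
def deletion (K : FinComplex α) (σ : Finset α) : FinComplex α where
  faces := K.faces.filter (fun τ => ¬ σ ⊆ τ)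
  down_closed := by
    intro s hs t hts
    rw [Finset.mem_filter] at hs ⊢
    exact ⟨K.down_closed s hs.1 t hts, fun h => hs.2 (h.trans hts)⟩

/-- The link of `σ` in `K`: the sets `τ` disjoint from `σ` such that `σ ∪ τ` is a face. -/
def link (K : FinComplex α) (σ : Finset α) : FinComplex α where
  faces := K.faces.filter (fun τ => Disjoint σ τ ∧ σ ∪ τ ∈ K.faces)
  down_closed := by
    intro s hs t hts
    rw [Finset.mem_filter] at hs ⊢
    exact ⟨K.down_closed s hs.1 t hts, hs.2.1.mono_right hts,
      K.down_closed _ hs.2.2 _ (Finset.union_subset_union_right hts)⟩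

/-- A shedding face `σ`: for every face `τ` containing `σ` and every `v ∈ σ` there is a vertex
`w ∉ τ` such that `(τ ∪ {w}) \ {v}` is a face. -/
def IsSheddingFace (K : FinComplex α) (σ : Finset α) : Prop :=
  σ ∈ K.faces ∧ ∀ τ ∈ K.faces, σ ⊆ τ → ∀ v ∈ σ, ∃ w, w ∉ τ ∧ (insert w τ).erase v ∈ K.faces

/-- `k`-decomposability of a (not necessarily pure) complex, for an integer `k`: a complex is
`k`-decomposable if it is a simplex (`{∅}` included) or has no face, or if it has a shedding face
`σ` of dimension at most `k` such that both `K \ σ` and the link of `σ` are `k`-decomposable. -/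
inductive IsDecomposable (k : ℤ) : FinComplex α → Prop
  | simplex (s : Finset α) : IsDecomposable k (simplex s)
  | void : IsDecomposable k void
  | shed (K : FinComplex α) (σ : Finset α) (hσ : K.IsSheddingFace σ) (hdim : faceDim σ ≤ k)
      (hdel : IsDecomposable k (K.deletion σ)) (hlink : IsDecomposable k (K.link σ)) :
      IsDecomposable k K

/-- Shellability (not necessarily pure): the facets can be listed without repetition as
`F 0, …, F (m - 1)` such that, for every `i ≥ 1`, the intersection of `F i` with the complex
generated by the earlier facets is pure of dimension `dim (F i) - 1`. -/
def IsShellable (K : FinComplex α) : Prop :=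
  ∃ (m : ℕ) (F : Fin m → Finset α), Function.Injective F ∧
    (∀ s, K.IsFacet s ↔ ∃ i, F i = s) ∧
    ∀ i : Fin m, 0 < (i : ℕ) →
      ((simplex (F i)).inter (generatedBy ((Finset.univ.filter (· < i)).image F))).IsPureOfDim
        (faceDim (F i) - 1)

/-- The pure `d`-skeleton: the complex generated by all faces of dimension `d`. -/
def pureSkeleton (K : FinComplex α) (d : ℤ) : FinComplex α :=
  generatedBy (K.faces.filter (fun s => faceDim s = d))

/-! Reduced simplicial homology is defined through the augmented complex of ordered chains: the
chains of degree `m - 1` are the `R`-linear combinations of all sequences `(x₀, …, x_{m-1})`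
(repetitions allowed) whose set of entries is a face. The empty sequence, for `m = 0`, spans the
chains of degree `-1`. -/

/-- The boundary `∂ (x₀, …, x_m) = ∑ i, (-1)^i (x₀, …, x̂_i, …, x_m)`. -/
noncomputable def boundary (R : Type w) [CommRing R] (α : Type u) (m : ℕ) :
    ((Fin (m + 1) → α) →₀ R) →ₗ[R] ((Fin m → α) →₀ R) :=
  Finsupp.linearCombination R (fun x =>
    ∑ i : Fin (m + 1), Finsupp.single (fun j => x (i.succAbove j)) ((-1 : R) ^ (i : ℕ)))

theorem boundary_comp_boundary (R : Type w) [CommRing R] (α : Type u) (m : ℕ) :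
    boundary R α m ∘ₗ boundary R α (m + 1) = 0 := by
  apply Finsupp.lhom_ext
  intro x r
  simp only [boundary, LinearMap.comp_apply, Finsupp.linearCombination_single, map_smul, map_sum,
    LinearMap.zero_apply]
  convert smul_zero r using 2
  simp only [Finset.smul_sum, Finsupp.smul_single, smul_eq_mul, ← pow_add]
  rw [← Finset.sum_product']
  rw [Finset.univ_product_univ, ← Finset.sum_filter_add_sum_filter_not Finset.univ
    (fun p : Fin (m + 2) × Fin (m + 1) => (p.2 : ℕ) < p.1), add_eq_zero_iff_eq_neg,
    ← Finset.sum_neg_distrib]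
  refine Finset.sum_bij' (fun p hp => (p.2.castSucc, p.1.pred (by
      simp only [Finset.mem_filter, Finset.mem_univ, true_and] at hp
      intro h; rw [h] at hp; simp at hp)))
    (fun p hp => (p.2.succ, p.1.castPred (by
      simp only [Finset.mem_filter, Finset.mem_univ, true_and] at hp
      intro h; rw [h] at hp; simp at hp; omega))) ?_ ?_ ?_ ?_ ?_
  · rintro ⟨i, j⟩ h
    simp at h ⊢; omega
  · rintro ⟨i, j⟩ h
    simp at h ⊢; omega
  · rintro ⟨i, j⟩ h; simp
  · rintro ⟨i, j⟩ h; simp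
  · rintro ⟨i, j⟩ h
    simp only [Finset.mem_filter, Finset.mem_univ, true_and] at h
    rw [← Finsupp.single_neg]
    congr 1
    · funext l
      congr 1
      ext
      simp only [Fin.succAbove, Fin.lt_def, Fin.val_castSucc, Fin.val_pred]
      split_ifs <;> simp_all <;> omega
    · obtain ⟨i, rfl⟩ := Fin.exists_succ_eq.2 (show i ≠ 0 by rintro rfl; simp at h)
      simp [pow_add, mul_comm]

/-- The ordered chains of `K` in degree `m - 1`. -/
def chains (R : Type w) [CommRing R] (K : FinComplex α) (m : ℕ) :
    Submodule R ((Fin m → α) →₀ R) :=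
  Finsupp.supported R R {x | Finset.univ.image x ∈ K.faces}

/-- The cycles in degree `m - 1`; every chain of degree `-1` is a cycle. -/
noncomputable def cycles (R : Type w) [CommRing R] (K : FinComplex α) :
    (m : ℕ) → Submodule R ((Fin m → α) →₀ R)
  | 0 => K.chains R 0
  | m + 1 => K.chains R (m + 1) ⊓ LinearMap.ker (boundary R α m)

/-- The boundaries in degree `m - 1`. -/
noncomputable def boundaries (R : Type w) [CommRing R] (K : FinComplex α) (m : ℕ) :
    Submodule R ((Fin m → α) →₀ R) :=
  (K.chains R (m + 1)).map (boundary R α m)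

theorem boundaries_le_cycles (R : Type w) [CommRing R] (K : FinComplex α) (m : ℕ) :
    K.boundaries R m ≤ K.cycles R m := by
  have h : K.boundaries R m ≤ K.chains R m := by
    rw [boundaries, chains, Finsupp.supported_eq_span_single, Submodule.map_span,
      Submodule.span_le]
    rintro _ ⟨_, ⟨x, hx, rfl⟩, rfl⟩
    simp only [boundary, Finsupp.linearCombination_single, one_smul]
    refine Submodule.sum_mem _ fun i _ => ?_
    refine Finsupp.single_mem_supported R _ ?_
    refine K.down_closed _ hx _ ?_
    intro a ha
    obtain ⟨j, -, rfl⟩ := Finset.mem_image.1 ha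
    exact Finset.mem_image_of_mem x (Finset.mem_univ _)
  cases m with
  | zero => exact h
  | succ m =>
    refine le_inf h ?_
    rintro _ ⟨y, -, rfl⟩
    exact LinearMap.congr_fun (boundary_comp_boundary R α m) y

/-- The reduced homology `Z ⧸ B` of `K` with coefficients in `R`, in degree `m - 1`, as the image
of the cycles `Z` in the quotient of all chains by the boundaries `B`. -/
noncomputable def reducedHomology (R : Type w) [CommRing R] (K : FinComplex α) (m : ℕ) :
    Submodule R (((Fin m → α) →₀ R) ⧸ K.boundaries R m) :=
  (K.cycles R m).map (K.boundaries R m).mkQ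

/-- `K` is Cohen–Macaulay over `R`: for every face `σ` (the empty face included), the reduced
homology of the link of `σ` vanishes in all degrees below the dimension of the link. -/
def IsCohenMacaulay (R : Type w) [CommRing R] (K : FinComplex α) : Prop :=
  ∀ σ ∈ K.faces, ∀ m : ℕ, (m : ℤ) - 1 < (K.link σ).dim →
    (K.link σ).reducedHomology R m = ⊥

/-- `K` is sequentially Cohen–Macaulay over `R`: all its pure skeleta are Cohen–Macaulay. -/
def IsSequentiallyCohenMacaulay (R : Type w) [CommRing R] (K : FinComplex α) : Prop :=
  ∀ d : ℤ, (K.pureSkeleton d).IsCohenMacaulay R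

end FinComplex

namespace Clutter

variable {α : Type u}

/-- The largest cardinality of a circuit (`0` if there is no circuit). -/
def maxCircuitCard (C : Clutter α) : ℕ := C.circuits.sup Finset.card

/-- An independent set: a set of vertices that contains no circuit. -/
def IsIndependent (C : Clutter α) (s : Finset α) : Prop :=
  s ⊆ C.verts ∧ ∀ e ∈ C.circuits, ¬ e ⊆ s

variable [DecidableEq α]

/-- The independence complex: its faces are the independent sets. -/
def independenceComplex (C : Clutter α) : FinComplex α where
  faces := C.verts.powerset.filter (fun s => ∀ e ∈ C.circuits, ¬ e ⊆ s)
  down_closed := by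
    intro s hs t hts
    rw [Finset.mem_filter, Finset.mem_powerset] at hs ⊢
    exact ⟨hts.trans hs.1, fun e he h => hs.2 e he (h.trans hts)⟩

/-- The inclusion-minimal members of a family of sets. -/
def minimalSets (S : Finset (Finset α)) : Finset (Finset α) :=
  S.filter (fun e => ∀ e' ∈ S, e' ⊆ e → e' = e)

/-- The contraction `C / v`: on the vertex set `V \ {v}`, its circuits are the minimal sets among
the `e \ {v}`, for `e` a circuit of `C`. -/
def contract (C : Clutter α) (v : α) : Clutter α where
  verts := C.verts.erase v
  circuits := minimalSets (C.circuits.image (fun e => e.erase v))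
  circuit_subset := by
    intro e he
    obtain ⟨e', he', rfl⟩ := Finset.mem_image.1 (Finset.mem_filter.1 he).1
    exact Finset.erase_subset_erase v (C.circuit_subset e' he')
  antichain := by
    intro e₁ h₁ e₂ h₂ h
    exact (Finset.mem_filter.1 h₂).2 e₁ (Finset.mem_filter.1 h₁).1 h

/-- `C.IsContraction D`: the clutter `D` is obtained from `C` by repeated (possibly zero)
contractions of vertices. -/
inductive IsContraction (C : Clutter α) : Clutter α → Prop
  | refl : IsContraction C C
  | step (D : Clutter α) (v : α) (hD : IsContraction C D) (hv : v ∈ D.verts) :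
      IsContraction C (D.contract v)

/-- A simplicial vertex `v`: for every two distinct circuits `e₁`, `e₂` that contain `v`, there is
a circuit contained in `(e₁ ∪ e₂) \ {v}`. -/
def IsSimplicialVertex (C : Clutter α) (v : α) : Prop :=
  v ∈ C.verts ∧ ∀ e₁ ∈ C.circuits, ∀ e₂ ∈ C.circuits, e₁ ≠ e₂ → v ∈ e₁ → v ∈ e₂ →
    ∃ e₃ ∈ C.circuits, e₃ ⊆ (e₁ ∪ e₂).erase v

end Clutter

/-!
For a circuit `e` through a simplicial vertex `v`, the set `e \ {v}` is a shedding face of the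
independence complex, always with `v` as the replacement vertex, and no face contains two of these
sets. They can therefore be removed one after the other without changing each other's links. What
remains is the closed star of `v`, a cone over the link of `v`. Since links of faces are
independence complexes of contractions, decomposability follows by induction on the number of
vertices.

Given a shedding face `σ` of a complex, a shelling of the deletion of `σ` can be continued by the
joins with `σ` of a shelling of its link: the shedding condition says that each new facet meets the
deletion in codimension one.

Finally, links, and the removal of the small facets, preserve shellings, so it suffices to see that
attaching a facet `F` creates no homology below the dimension of `F`. If `F` is attached along its
whole boundary, this is clear. Otherwise it is attached along a cone, and the Mayer–Vietoris
argument applies.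
-/

namespace FinComplex

open Finset

/-! ### Faces, links and cones -/

section

variable {α : Type u} {K L : FinComplex α} {s : Finset α}

theorem ext_mem (h : ∀ s, s ∈ K.faces ↔ s ∈ L.faces) : K = L :=
  FinComplex.ext (Finset.ext h)

theorem exists_isFacet_superset (hs : s ∈ K.faces) : ∃ F, K.IsFacet F ∧ s ⊆ F := by
  obtain ⟨F, hsF, hF⟩ := K.faces.exists_le_maximal hs
  exact ⟨F, ⟨hF.prop, fun t ht h => (hF.eq_of_le ht h).symm⟩, hsF⟩

theorem exists_card_eq_dim_add_one (hK : K.faces.Nonempty) :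
    ∃ s ∈ K.faces, (#s : ℤ) = K.dim + 1 := by
  obtain ⟨s, hs, hsup⟩ := exists_mem_eq_sup K.faces hK card
  exact ⟨s, hs, by rw [dim, hsup, sub_add_cancel]⟩

@[simp]
theorem notMem_void : s ∉ (void : FinComplex α).faces :=
  Finset.notMem_empty s

theorem eq_void (h : ∀ s, s ∉ K.faces) : K = void :=
  ext_mem fun s => iff_of_false (h s) notMem_void

end

variable {α : Type u} [DecidableEq α] {K L : FinComplex α} {S : Finset (Finset α)}
  {F σ τ s : Finset α} {v : α} {k : ℤ}

@[simp]
theorem mem_generatedBy : s ∈ (generatedBy S).faces ↔ ∃ F ∈ S, s ⊆ F := by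
  simp [generatedBy]

@[simp]
theorem mem_simplex : s ∈ (simplex F).faces ↔ s ⊆ F := by
  simp [simplex]

@[simp]
theorem mem_inter : s ∈ (K.inter L).faces ↔ s ∈ K.faces ∧ s ∈ L.faces :=
  Finset.mem_inter

@[simp]
theorem mem_deletion : s ∈ (K.deletion σ).faces ↔ s ∈ K.faces ∧ ¬ σ ⊆ s :=
  mem_filter

@[simp]
theorem mem_link : s ∈ (K.link σ).faces ↔ Disjoint σ s ∧ σ ∪ s ∈ K.faces := by
  simp only [link, mem_filter, and_iff_right_iff_imp]
  exact fun h => K.down_closed _ h.2 _ subset_union_right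

theorem mem_link_singleton : s ∈ (K.link {v}).faces ↔ v ∉ s ∧ insert v s ∈ K.faces := by
  rw [mem_link, disjoint_singleton_left, singleton_union]

theorem link_empty (K : FinComplex α) : K.link ∅ = K :=
  ext_mem fun s => by simp

theorem link_comm (K : FinComplex α) (σ τ : Finset α) :
    (K.link σ).link τ = (K.link τ).link σ :=
  ext_mem fun s => by
    simp only [mem_link, disjoint_union_right, union_left_comm σ τ s,
      disjoint_comm (a := σ) (b := τ)]
    tauto

theorem link_link (hστ : Disjoint σ τ) : (K.link σ).link τ = K.link (σ ∪ τ) :=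
  ext_mem fun s => by
    simp only [mem_link, disjoint_union_right, disjoint_union_left, hστ, union_assoc]
    tauto

theorem link_deletion (hστ : Disjoint σ τ) :
    (K.deletion σ).link τ = (K.link τ).deletion σ :=
  ext_mem fun s => by
    have : σ ⊆ τ ∪ s ↔ σ ⊆ s :=
      ⟨hστ.left_le_of_le_sup_left, fun h => h.trans subset_union_right⟩
    simp only [mem_link, mem_deletion, this]
    tauto

/-- `K` is a cone with apex `v`: adding `v` to a face gives a face. The complex `{}` counts as a
cone with every apex. -/
def IsCone (K : FinComplex α) (v : α) : Prop :=
  ∀ s ∈ K.faces, insert v s ∈ K.faces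

theorem isCone_simplex (hv : v ∈ F) : (simplex F).IsCone v := fun _ hs =>
  mem_simplex.2 (insert_subset hv (mem_simplex.1 hs))

namespace IsCone

theorem mem_iff_erase_mem_link (hK : K.IsCone v) :
    s ∈ K.faces ↔ s.erase v ∈ (K.link {v}).faces := by
  rw [mem_link_singleton, show insert v (s.erase v) = insert v s by grind]
  exact ⟨fun hs => ⟨notMem_erase v s, hK s hs⟩,
    fun hs => K.down_closed _ hs.2 _ (subset_insert v s)⟩

theorem deletion (hK : K.IsCone v) (hv : v ∉ σ) : (K.deletion σ).IsCone v := by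
  intro s hs
  rw [mem_deletion] at hs ⊢
  exact ⟨hK s hs.1, by rw [subset_insert_iff_of_notMem hv]; exact hs.2⟩

theorem link (hK : K.IsCone v) (hv : v ∉ σ) : (K.link σ).IsCone v := by
  intro s hs
  rw [mem_link] at hs ⊢
  rw [disjoint_insert_right, union_insert]
  exact ⟨⟨hv, hs.1⟩, hK _ hs.2⟩

theorem isSheddingFace (hK : K.IsCone v) (hσ : (K.link {v}).IsSheddingFace σ) :
    K.IsSheddingFace σ := by
  obtain ⟨hvσ, hσK⟩ := mem_link_singleton.1 hσ.1
  refine ⟨K.down_closed _ hσK _ (subset_insert v σ), fun τ hτ hστ x hx => ?_⟩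
  obtain ⟨w, hw, hwL⟩ :=
    hσ.2 _ (hK.mem_iff_erase_mem_link.1 hτ) (subset_erase.2 ⟨hστ, hvσ⟩) x hx
  have hxv : v ≠ x := by rintro rfl; exact hvσ hx
  have hwv : w ≠ v := by
    rintro rfl
    exact (mem_link_singleton.1 hwL).1 (mem_erase.2 ⟨hxv, mem_insert_self w _⟩)
  refine ⟨w, fun h => hw (mem_erase.2 ⟨hwv, h⟩), hK.mem_iff_erase_mem_link.2 ?_⟩
  rwa [erase_right_comm, erase_insert_of_ne hwv]

theorem isDecomposable (hK : K.IsCone v) (h : (K.link {v}).IsDecomposable k) :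
    K.IsDecomposable k := by
  generalize hL : K.link {v} = L at h
  induction h generalizing K with
  | simplex s =>
    have : K = FinComplex.simplex (insert v s) := ext_mem fun t => by
      rw [hK.mem_iff_erase_mem_link, hL, mem_simplex, mem_simplex, subset_insert_iff]
    exact this ▸ .simplex _
  | void =>
    have : K = FinComplex.void := eq_void fun t ht => by
      rw [hK.mem_iff_erase_mem_link, hL] at ht
      exact notMem_void ht
    exact this ▸ .void
  | shed L σ hσ hdim _ _ ihdel ihlink =>
    subst hL
    have hvσ : v ∉ σ := (mem_link_singleton.1 hσ.1).1
    exact .shed K σ (hK.isSheddingFace hσ) hdim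
      (ihdel (hK.deletion hvσ) (link_deletion (disjoint_singleton_right.2 hvσ)))
      (ihlink (hK.link hvσ) (link_comm K σ {v}))

end IsCone

/-! ### Simultaneous removal of shedding faces -/

theorem IsDecomposable.of_forall_eq_empty (h : ∀ s ∈ K.faces, s = ∅) : K.IsDecomposable k := by
  by_cases h₀ : ∅ ∈ K.faces
  · have : K = FinComplex.simplex ∅ := ext_mem fun s => by
      rw [mem_simplex, subset_empty]
      exact ⟨h s, fun hs => hs ▸ h₀⟩
    exact this ▸ .simplex ∅
  · have : K = FinComplex.void := eq_void fun s hs => h₀ (h s hs ▸ hs)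
    exact this ▸ .void

/-- The vertex `v` sheds `σ`: `σ` is a shedding face in which `v` can serve as the replacement
vertex `w` for every face `τ ⊇ σ` and every vertex of `σ`. -/
def IsShedBy (K : FinComplex α) (v : α) (σ : Finset α) : Prop :=
  σ ∈ K.faces ∧ ∀ τ ∈ K.faces, σ ⊆ τ → v ∉ τ ∧ ∀ x ∈ σ, (insert v τ).erase x ∈ K.faces

/-- The iterated deletion of all members of `T`: the faces that contain no member of `T`. -/
def deletionAll (K : FinComplex α) (T : Finset (Finset α)) : FinComplex α where
  faces := {s ∈ K.faces | ∀ σ ∈ T, ¬ σ ⊆ s}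
  down_closed s hs t hts := by
    rw [mem_filter] at hs ⊢
    exact ⟨K.down_closed s hs.1 t hts, fun σ hσ h => hs.2 σ hσ (h.trans hts)⟩

@[simp]
theorem mem_deletionAll {T : Finset (Finset α)} :
    s ∈ (K.deletionAll T).faces ↔ s ∈ K.faces ∧ ∀ σ ∈ T, ¬ σ ⊆ s :=
  mem_filter

theorem deletionAll_insert (T : Finset (Finset α)) :
    K.deletionAll (insert σ T) = (K.deletionAll T).deletion σ :=
  ext_mem fun s => by
    simp only [mem_deletionAll, mem_deletion, forall_mem_insert]
    tauto

section

variable {T : Finset (Finset α)}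

theorem mem_deletionAll_iff_of_subset (hσT : ∀ ρ ∈ T, σ ∪ ρ ∉ K.faces) (hστ : σ ⊆ τ) :
    τ ∈ (K.deletionAll T).faces ↔ τ ∈ K.faces := by
  rw [mem_deletionAll, and_iff_left_iff_imp]
  exact fun hτ ρ hρ hρτ => hσT ρ hρ (K.down_closed τ hτ _ (union_subset hστ hρτ))

theorem link_deletionAll (hσT : ∀ ρ ∈ T, σ ∪ ρ ∉ K.faces) :
    (K.deletionAll T).link σ = K.link σ :=
  ext_mem fun s => by
    rw [mem_link, mem_link, mem_deletionAll_iff_of_subset hσT subset_union_left]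

theorem IsShedBy.isSheddingFace_deletionAll (hσ : K.IsShedBy v σ) (hvT : ∀ ρ ∈ T, v ∉ ρ)
    (hσT : ∀ ρ ∈ T, σ ∪ ρ ∉ K.faces) : (K.deletionAll T).IsSheddingFace σ := by
  refine ⟨(mem_deletionAll_iff_of_subset hσT subset_rfl).2 hσ.1, fun τ hτ hστ x hx => ?_⟩
  rw [mem_deletionAll] at hτ
  obtain ⟨hvτ, hshed⟩ := hσ.2 τ hτ.1 hστ
  refine ⟨v, hvτ, mem_deletionAll.2 ⟨hshed x hx, fun ρ hρ hsub => hτ.2 ρ hρ ?_⟩⟩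
  exact (subset_insert_iff_of_notMem (hvT ρ hρ)).1 (hsub.trans (erase_subset x _))

theorem IsDecomposable.of_deletionAll (hshed : ∀ σ ∈ T, K.IsShedBy v σ)
    (hT : ∀ σ ∈ T, ∀ ρ ∈ T, σ ≠ ρ → σ ∪ ρ ∉ K.faces) (hdim : ∀ σ ∈ T, faceDim σ ≤ k)
    (hlink : ∀ σ ∈ T, (K.link σ).IsDecomposable k) (hdel : (K.deletionAll T).IsDecomposable k) :
    K.IsDecomposable k := by
  induction T using Finset.induction_on with
  | empty => rwa [show K.deletionAll ∅ = K from ext_mem fun s => by simp] at hdel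
  | insert σ T hσT ih =>
    rw [forall_mem_insert] at hshed hdim hlink
    have hσρ : ∀ ρ ∈ T, σ ∪ ρ ∉ K.faces := fun ρ hρ =>
      hT σ (mem_insert_self σ T) ρ (mem_insert_of_mem hρ) fun h => hσT (h ▸ hρ)
    have hvT : ∀ ρ ∈ T, v ∉ ρ := fun ρ hρ => ((hshed.2 ρ hρ).2 ρ (hshed.2 ρ hρ).1 subset_rfl).1
    refine ih hshed.2 (fun ρ hρ ρ' hρ' => hT ρ (mem_insert_of_mem hρ) ρ' (mem_insert_of_mem hρ'))
      hdim.2 hlink.2 (.shed _ σ (hshed.1.isSheddingFace_deletionAll hvT hσρ) hdim.1 ?_ ?_)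
    · rwa [← deletionAll_insert]
    · rw [link_deletionAll hσρ]
      exact hlink.1

end

/-! ### Facets -/

/-- The finite set of facets. -/
def facets (K : FinComplex α) : Finset (Finset α) :=
  {s ∈ K.faces | ∀ t ∈ K.faces, s ⊆ t → t = s}

@[simp]
theorem mem_facets : s ∈ K.facets ↔ K.IsFacet s :=
  mem_filter

theorem isAntichain_facets (K : FinComplex α) : IsAntichain (· ⊆ ·) (K.facets : Set (Finset α)) :=
  fun _ hs t ht hne hst => hne ((mem_facets.1 hs).2 t (mem_facets.1 ht).1 hst).symm

theorem facets_void : (void : FinComplex α).facets = ∅ :=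
  eq_empty_of_forall_notMem fun _ hs => notMem_void (mem_facets.1 hs).1

theorem facets_simplex (F : Finset α) : (simplex F).facets = {F} := by
  ext s
  simp only [mem_facets, IsFacet, mem_simplex, mem_singleton]
  constructor
  · exact fun h => (h.2 F subset_rfl h.1).symm
  · rintro rfl
    exact ⟨subset_rfl, fun t hts hst => hts.antisymm hst⟩

theorem isFacet_union_iff (hd : Disjoint σ τ) : K.IsFacet (σ ∪ τ) ↔ (K.link σ).IsFacet τ := by
  constructor
  · rintro ⟨hτ, hmax⟩
    refine ⟨mem_link.2 ⟨hd, hτ⟩, fun t ht hτt => ?_⟩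
    obtain ⟨hdt, ht⟩ := mem_link.1 ht
    rw [← union_sdiff_cancel_left hdt, hmax _ ht (union_subset_union_right hτt),
      union_sdiff_cancel_left hd]
  · rintro ⟨hτ, hmax⟩
    refine ⟨(mem_link.1 hτ).2, fun t ht hsub => ?_⟩
    have hσt : σ ∪ t \ σ = t := union_sdiff_of_subset (subset_union_left.trans hsub)
    rw [← hσt, hmax (t \ σ) (mem_link.2 ⟨disjoint_sdiff, hσt.symm ▸ ht⟩)
      (subset_sdiff.2 ⟨subset_union_right.trans hsub, hd.symm⟩)]

theorem IsSheddingFace.isFacet_deletion_iff (hσ : K.IsSheddingFace σ) :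
    (K.deletion σ).IsFacet s ↔ K.IsFacet s ∧ ¬ σ ⊆ s := by
  constructor
  · rintro ⟨hs, hmax⟩
    obtain ⟨hsK, hσs⟩ := mem_deletion.1 hs
    refine ⟨⟨hsK, fun t ht hst => hmax t (mem_deletion.2 ⟨ht, fun hσt => ?_⟩) hst⟩, hσs⟩
    obtain ⟨x, hx, hxs⟩ := not_subset.1 hσs
    obtain ⟨w, hw, hwK⟩ := hσ.2 t ht hσt x hx
    have hwx : w ≠ x := by rintro rfl; exact hw (hσt hx)
    have heq : (insert w t).erase x = s :=
      hmax _ (mem_deletion.2 ⟨hwK, fun h => notMem_erase x _ (h hx)⟩)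
        (subset_erase.2 ⟨hst.trans (subset_insert w t), hxs⟩)
    exact hw (hst (heq ▸ mem_erase.2 ⟨hwx, mem_insert_self w t⟩))
  · rintro ⟨⟨hs, hmax⟩, hσs⟩
    exact ⟨mem_deletion.2 ⟨hs, hσs⟩, fun t ht => hmax t (mem_deletion.1 ht).1⟩

theorem IsSheddingFace.facets_eq (hσ : K.IsSheddingFace σ) :
    K.facets = (K.deletion σ).facets ∪ (K.link σ).facets.image (σ ∪ ·) := by
  ext s
  simp only [mem_union, mem_image, mem_facets, hσ.isFacet_deletion_iff]
  constructor
  · intro hs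
    by_cases hσs : σ ⊆ s
    · refine .inr ⟨s \ σ, (isFacet_union_iff disjoint_sdiff).1 ?_, union_sdiff_of_subset hσs⟩
      rwa [union_sdiff_of_subset hσs]
    · exact .inl ⟨hs, hσs⟩
  · rintro (hs | ⟨G, hG, rfl⟩)
    · exact hs.1
    · exact (isFacet_union_iff (mem_link.1 hG.1).1).2 hG

/-! ### Shellings -/

/-- The simplex on `F` meets the complex generated by `S` in a complex generated by sets
`F \ {x}` with `x ∈ F`. -/
def MeetsInCodimOne (F : Finset α) (S : Finset (Finset α)) : Prop :=
  ∀ G ∈ S, ∃ x ∈ F, x ∉ G ∧ ∃ H ∈ S, F.erase x ⊆ H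

theorem isPureOfDim_inter_generatedBy_iff :
    ((simplex F).inter (generatedBy S)).IsPureOfDim (faceDim F - 1) ↔
      S.Nonempty ∧ MeetsInCodimOne F S := by
  constructor
  · rintro ⟨⟨s, hs⟩, hpure⟩
    obtain ⟨G, hG, -⟩ := mem_generatedBy.1 (mem_inter.1 hs).2
    refine ⟨⟨G, hG⟩, fun G hG => ?_⟩
    obtain ⟨t, ht, hFGt⟩ := exists_isFacet_superset (K := (simplex F).inter (generatedBy S))
      (s := F ∩ G) (mem_inter.2 ⟨mem_simplex.2 inter_subset_left,
        mem_generatedBy.2 ⟨G, hG, inter_subset_right⟩⟩)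
    obtain ⟨htF, H, hH, htH⟩ := by simpa only [mem_inter, mem_simplex, mem_generatedBy] using ht.1
    have hcard : #t + 1 = #F := by
      have := hpure t ht
      simp only [faceDim] at this
      omega
    obtain ⟨x, hxt, rfl⟩ := exists_eq_insert_iff.2 ⟨htF, hcard⟩
    refine ⟨x, mem_insert_self x t, fun hxG => hxt (hFGt ?_), H, hH, ?_⟩
    · exact Finset.mem_inter.2 ⟨mem_insert_self x t, hxG⟩
    · rwa [erase_insert hxt]
  · rintro ⟨⟨G, hG⟩, hF⟩
    refine ⟨⟨∅, mem_inter.2 ⟨mem_simplex.2 (empty_subset F),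
      mem_generatedBy.2 ⟨G, hG, empty_subset G⟩⟩⟩, ?_⟩
    rintro s ⟨hs, hmax⟩
    obtain ⟨hsF, G, hG, hsG⟩ := by simpa only [mem_inter, mem_simplex, mem_generatedBy] using hs
    obtain ⟨x, hxF, hxG, H, hH, hsub⟩ := hF G hG
    have hs_eq : F.erase x = s :=
      hmax _ (mem_inter.2 ⟨mem_simplex.2 (erase_subset x F), mem_generatedBy.2 ⟨H, hH, hsub⟩⟩)
        (subset_erase.2 ⟨hsF, fun hxs => hxG (hsG hxs)⟩)
    simp only [faceDim, ← hs_eq, card_erase_of_mem hxF, Nat.cast_pred (card_pos.2 ⟨x, hxF⟩)]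

/-- The sequence `F` is a shelling of the complex generated by its members. -/
def IsShellingOrder {m : ℕ} (F : Fin m → Finset α) : Prop :=
  ∀ i, MeetsInCodimOne (F i) ((Iio i).image F)

theorem IsShellingOrder.injective {m : ℕ} {F : Fin m → Finset α} (hF : IsShellingOrder F) :
    Function.Injective F := by
  refine .of_lt_imp_ne fun j i hji heq => ?_
  obtain ⟨x, hxi, hxj, -⟩ := hF i (F j) (mem_image_of_mem F (mem_Iio.2 hji))
  exact hxj (heq ▸ hxi)

theorem isShellingOrder_succ_iff {m : ℕ} {F : Fin (m + 1) → Finset α} :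
    IsShellingOrder F ↔ IsShellingOrder (F ∘ Fin.castSucc) ∧
      MeetsInCodimOne (F (Fin.last m)) (univ.image (F ∘ Fin.castSucc)) := by
  have himage (i : Fin m) : (Iio i.castSucc).image F = (Iio i).image (F ∘ Fin.castSucc) := by
    rw [← Fin.finsetImage_castSucc_Iio, image_image]
  have himage_last : (Iio (Fin.last m)).image F = univ.image (F ∘ Fin.castSucc) := by
    rw [Fin.Iio_last_eq_map, map_eq_image, image_image, Fin.coe_castSuccEmb]
  simp only [IsShellingOrder, Fin.forall_fin_succ', himage, himage_last, Function.comp_apply]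

/-- A family of sets whose members can be listed in an order that shells the complex they
generate. -/
inductive IsShellableFamily : Finset (Finset α) → Prop
  | empty : IsShellableFamily ∅
  | insert (F : Finset α) (S : Finset (Finset α)) (hS : IsShellableFamily S)
      (hF : MeetsInCodimOne F S) : IsShellableFamily (insert F S)

theorem IsShellingOrder.isShellableFamily {m : ℕ} {F : Fin m → Finset α} (hF : IsShellingOrder F) :
    IsShellableFamily (univ.image F) := by
  induction m with
  | zero => exact .empty
  | succ m ih =>
    obtain ⟨hinit, hlast⟩ := isShellingOrder_succ_iff.1 hF
    have : univ.image F = insert (F (Fin.last m)) (univ.image (F ∘ Fin.castSucc)) := by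
      rw [Fin.univ_castSuccEmb, cons_eq_insert, image_insert, map_eq_image, image_image,
        Fin.coe_castSuccEmb]
    exact this ▸ .insert _ _ (ih hinit) hlast

theorem IsShellableFamily.exists_isShellingOrder (hS : IsShellableFamily S) :
    ∃ (m : ℕ) (F : Fin m → Finset α), IsShellingOrder F ∧ univ.image F = S := by
  induction hS with
  | empty => exact ⟨0, Fin.elim0, fun i => i.elim0, rfl⟩
  | insert G S _ hG ih =>
    obtain ⟨m, F, hF, rfl⟩ := ih
    have hinit : (Fin.snoc F G : Fin (m + 1) → Finset α) ∘ Fin.castSucc = F :=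
      Fin.init_snoc (α := fun _ => Finset α) G F
    refine ⟨m + 1, Fin.snoc F G, isShellingOrder_succ_iff.2 ?_, ?_⟩
    · rw [hinit, Fin.snoc_last]
      exact ⟨hF, hG⟩
    · rw [Fin.univ_castSuccEmb, cons_eq_insert, image_insert, map_eq_image, image_image,
        Fin.coe_castSuccEmb, hinit, Fin.snoc_last]

theorem isShellable_iff_exists_isShellingOrder :
    K.IsShellable ↔
      ∃ (m : ℕ) (F : Fin m → Finset α), IsShellingOrder F ∧ univ.image F = K.facets := by
  have hfacets {m : ℕ} (F : Fin m → Finset α) :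
      (∀ s, K.IsFacet s ↔ ∃ i, F i = s) ↔ univ.image F = K.facets := by
    simp only [Finset.ext_iff, mem_image_univ_iff_mem_range, Set.mem_range, mem_facets]
    exact forall_congr' fun s => Iff.comm
  simp only [IsShellable, hfacets, filter_gt_eq_Iio, isPureOfDim_inter_generatedBy_iff]
  refine exists₂_congr fun m F => ⟨fun ⟨_, hF, hsteps⟩ => ⟨fun i => ?_, hF⟩,
    fun ⟨hsteps, hF⟩ => ⟨hsteps.injective, hF, fun i hi => ⟨?_, hsteps i⟩⟩⟩
  · rcases Nat.eq_zero_or_pos i with hi | hi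
    · intro G hG
      obtain ⟨j, hj, -⟩ := mem_image.1 hG
      exact absurd (Fin.lt_def.1 (mem_Iio.1 hj)) (by omega)
    · exact (hsteps i hi).2
  · exact ⟨_, mem_image_of_mem F (mem_Iio.2 (Fin.lt_def.2 hi : ⟨0, i.pos⟩ < i))⟩

theorem isShellable_iff_isShellableFamily_facets :
    K.IsShellable ↔ IsShellableFamily K.facets := by
  rw [isShellable_iff_exists_isShellingOrder]
  exact ⟨fun ⟨_, _, hF, h⟩ => h ▸ hF.isShellableFamily, fun h => h.exists_isShellingOrder⟩

theorem IsShellableFamily.union_image_union {S₀ : Finset (Finset α)} (h₀ : IsShellableFamily S₀)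
    (hS : IsShellableFamily S) (hσ₀ : ∀ G ∈ S₀, ¬ σ ⊆ G) (hdisj : ∀ G ∈ S, Disjoint σ G)
    (hridge : ∀ G ∈ S, ∀ x ∈ σ, ∃ H ∈ S₀, (σ ∪ G).erase x ⊆ H) :
    IsShellableFamily (S₀ ∪ S.image (σ ∪ ·)) := by
  induction hS with
  | empty => rwa [image_empty, union_empty]
  | insert F S _ hF ih =>
    rw [forall_mem_insert] at hdisj hridge
    rw [image_insert, union_insert]
    refine .insert _ _ (ih hdisj.2 hridge.2) fun G hG => ?_
    rcases mem_union.1 hG with hG | hG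
    · obtain ⟨x, hxσ, hxG⟩ := not_subset.1 (hσ₀ G hG)
      obtain ⟨H, hH, hsub⟩ := hridge.1 x hxσ
      exact ⟨x, mem_union_left F hxσ, hxG, H, mem_union_left _ hH, hsub⟩
    · obtain ⟨G, hGS, rfl⟩ := mem_image.1 hG
      obtain ⟨x, hxF, hxG, H, hH, hsub⟩ := hF G hGS
      have hxσ : x ∉ σ := disjoint_right.1 hdisj.1 hxF
      refine ⟨x, mem_union_right σ hxF, by simp [hxσ, hxG], σ ∪ H,
        mem_union_right S₀ (mem_image_of_mem _ hH), ?_⟩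
      rw [erase_union_distrib, erase_eq_of_notMem hxσ]
      exact union_subset_union_right hsub

theorem IsDecomposable.isShellable (h : K.IsDecomposable k) : K.IsShellable := by
  rw [isShellable_iff_isShellableFamily_facets]
  induction h with
  | simplex s =>
    rw [facets_simplex]
    exact .insert s ∅ .empty fun _ hG => absurd hG (notMem_empty _)
  | void =>
    rw [facets_void]
    exact .empty
  | shed K σ hσ _ _ _ ihdel ihlink =>
    rw [hσ.facets_eq]
    refine ihdel.union_image_union ihlink (fun G hG => ?_) (fun G hG => ?_) fun G hG x hx => ?_
    · exact (mem_deletion.1 (mem_facets.1 hG).1).2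
    · exact (mem_link.1 (mem_facets.1 hG).1).1
    · obtain ⟨F, hF, hsub⟩ := exists_isFacet_superset (K := K.deletion σ) (s := (σ ∪ G).erase x) <|
        mem_deletion.2 ⟨K.down_closed _ (mem_link.1 (mem_facets.1 hG).1).2 _ (erase_subset x _),
          fun h => notMem_erase x _ (h hx)⟩
      exact ⟨F, mem_facets.2 hF, hsub⟩

theorem IsShellableFamily.filter_le_card (hS : IsShellableFamily S)
    (hanti : IsAntichain (· ⊆ ·) (S : Set (Finset α))) (n : ℕ) :
    IsShellableFamily {F ∈ S | n ≤ #F} := by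
  induction hS with
  | empty => exact .empty
  | insert F S _ hF ih =>
    have ih := ih (hanti.subset (coe_subset.2 (subset_insert F S)))
    rw [filter_insert]
    split_ifs with hn
    · refine .insert F _ ih fun G hG => ?_
      obtain ⟨x, hxF, hxG, H, hH, hsub⟩ := hF G (mem_filter.1 hG).1
      refine ⟨x, hxF, hxG, H, mem_filter.2 ⟨hH, ?_⟩, hsub⟩
      have hHF : ¬ H ⊆ F := fun h => by
        obtain rfl : H = F := hanti.eq (mem_insert_of_mem hH) (mem_insert_self F S) h
        obtain ⟨y, hy, hyH, -⟩ := hF H hH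
        exact hyH hy
      have hlt : #(F.erase x) < #H :=
        card_lt_card (hsub.ssubset_of_ne fun h => hHF (h ▸ erase_subset x F))
      rw [card_erase_of_mem hxF] at hlt
      omega
    · exact ih

theorem IsShellableFamily.image_sdiff (hS : IsShellableFamily S) (σ : Finset α) :
    IsShellableFamily ({F ∈ S | σ ⊆ F}.image (· \ σ)) := by
  induction hS with
  | empty => exact .empty
  | insert F S _ hF ih =>
    rw [filter_insert]
    split_ifs with hσF
    · rw [image_insert]
      refine .insert _ _ ih (forall_mem_image.2 fun G hG => ?_)
      obtain ⟨hG, hσG⟩ := mem_filter.1 hG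
      obtain ⟨x, hxF, hxG, H, hH, hsub⟩ := hF G hG
      have hxσ : x ∉ σ := fun h => hxG (hσG h)
      refine ⟨x, mem_sdiff.2 ⟨hxF, hxσ⟩, fun h => hxG (mem_sdiff.1 h).1, H \ σ,
        mem_image_of_mem _ (mem_filter.2 ⟨hH, (subset_erase.2 ⟨hσF, hxσ⟩).trans hsub⟩), ?_⟩
      rw [← erase_sdiff_comm]
      exact sdiff_subset_sdiff hsub subset_rfl
    · exact ih

theorem link_generatedBy (S : Finset (Finset α)) (σ : Finset α) :
    (generatedBy S).link σ = generatedBy ({F ∈ S | σ ⊆ F}.image (· \ σ)) :=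
  ext_mem fun s => by
    simp only [mem_link, mem_generatedBy, exists_mem_image, mem_filter, union_subset_iff,
      subset_sdiff, disjoint_comm (a := s)]
    grind

/-! ### Reduced homology -/

section ConeMap

variable (R : Type w) [CommRing R] {α : Type u} (y : α)

/-- The cone operator `(x₀, …, x_{m-1}) ↦ (y, x₀, …, x_{m-1})` on ordered chains. -/
noncomputable def coneMap (m : ℕ) : ((Fin m → α) →₀ R) →ₗ[R] ((Fin (m + 1) → α) →₀ R) :=
  Finsupp.lmapDomain R R (Fin.cons (α := fun _ => α) y)

variable {R}

@[simp]
theorem coneMap_single {m : ℕ} (x : Fin m → α) (r : R) :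
    coneMap R y m (.single x r) = .single (Fin.cons y x) r :=
  Finsupp.mapDomain_single

@[simp]
theorem boundary_single {m : ℕ} (x : Fin (m + 1) → α) (r : R) :
    boundary R α m (.single x r) =
      r • ∑ i : Fin (m + 1), .single (fun j => x (i.succAbove j)) ((-1 : R) ^ (i : ℕ)) :=
  Finsupp.linearCombination_single R r x

theorem boundary_coneMap_zero (z : (Fin 0 → α) →₀ R) : boundary R α 0 (coneMap R y 0 z) = z := by
  induction z using Finsupp.induction_linear with
  | zero => simp only [map_zero]
  | add f g hf hg => simp only [map_add, hf, hg]
  | single x r => simp [Subsingleton.elim _ x]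

theorem boundary_coneMap_succ (m : ℕ) (z : (Fin (m + 1) → α) →₀ R) :
    boundary R α (m + 1) (coneMap R y (m + 1) z) = z - coneMap R y m (boundary R α m z) := by
  induction z using Finsupp.induction_linear with
  | zero => simp only [map_zero, sub_zero]
  | add f g hf hg => simp only [map_add, hf, hg]; abel
  | single x r =>
    have hface (i : Fin (m + 1)) :
        (fun j => (Fin.cons y x : Fin (m + 2) → α) (i.succ.succAbove j)) =
          Fin.cons y fun j => x (i.succAbove j) :=
      funext fun j => j.cases (by simp) fun j => by simp
    simp [Fin.sum_univ_succ (n := m + 1), hface, pow_succ, sub_eq_add_neg]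

end ConeMap

variable {R : Type w} [CommRing R] {m : ℕ}

theorem reducedHomology_eq_bot_iff :
    K.reducedHomology R m = ⊥ ↔ K.cycles R m ≤ K.boundaries R m := by
  rw [reducedHomology, ← le_bot_iff, Submodule.map_le_iff_le_comap, Submodule.comap_bot,
    Submodule.ker_mkQ]

theorem mem_chains {z : (Fin m → α) →₀ R} :
    z ∈ K.chains R m ↔ ∀ x ∈ z.support, univ.image x ∈ K.faces :=
  Iff.rfl

theorem cycles_le_chains : K.cycles R m ≤ K.chains R m := by
  cases m with
  | zero => exact le_rfl
  | succ m => exact inf_le_left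

theorem boundary_mem_cycles {z : (Fin (m + 1) → α) →₀ R} (hz : z ∈ K.chains R (m + 1)) :
    boundary R α m z ∈ K.cycles R m :=
  K.boundaries_le_cycles R m ⟨z, hz, rfl⟩

theorem chains_mono (h : K.faces ⊆ L.faces) : K.chains R m ≤ L.chains R m :=
  Finsupp.supported_mono fun _ hx => h hx

theorem boundaries_mono (h : K.faces ⊆ L.faces) : K.boundaries R m ≤ L.boundaries R m :=
  Submodule.map_mono (chains_mono h)

theorem chains_inter : (K.inter L).chains R m = K.chains R m ⊓ L.chains R m := by
  rw [chains, chains, chains, ← Finsupp.supported_inter]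
  simp only [mem_inter, Set.ofPred_and]

theorem chains_congr (h : ∀ s, #s ≤ m → (s ∈ K.faces ↔ s ∈ L.faces)) :
    K.chains R m = L.chains R m := by
  ext z
  exact forall₂_congr fun x _ => h _ (card_image_le.trans (card_fin m).le)

theorem cycles_congr (h : ∀ s, #s ≤ m → (s ∈ K.faces ↔ s ∈ L.faces)) :
    K.cycles R m = L.cycles R m := by
  cases m with
  | zero => exact chains_congr h
  | succ m => rw [cycles, cycles, chains_congr h]

theorem reducedHomology_eq_bot_congr (h : ∀ s, #s ≤ m + 1 → (s ∈ K.faces ↔ s ∈ L.faces)) :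
    K.reducedHomology R m = ⊥ ↔ L.reducedHomology R m = ⊥ := by
  rw [reducedHomology_eq_bot_iff, reducedHomology_eq_bot_iff, boundaries, boundaries,
    chains_congr h, cycles_congr fun s hs => h s (hs.trans m.le_succ)]

theorem reducedHomology_void : (void : FinComplex α).reducedHomology R m = ⊥ := by
  rw [reducedHomology_eq_bot_iff]
  intro z hz
  have hsupp : z.support = ∅ :=
    eq_empty_of_forall_notMem fun x hx => notMem_void (mem_chains.1 (cycles_le_chains hz) x hx)
  rw [Finsupp.support_eq_empty.1 hsupp]
  exact zero_mem _

theorem IsCone.coneMap_mem_chains {y : α} (hK : K.IsCone y) {z : (Fin m → α) →₀ R}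
    (hz : z ∈ K.chains R m) : coneMap R y m z ∈ K.chains R (m + 1) := by
  rw [mem_chains] at hz ⊢
  intro x hx
  obtain ⟨x, hx', rfl⟩ := mem_image.1 (Finsupp.mapDomain_support hx)
  have himage : univ.image (Fin.cons y x : Fin (m + 1) → α) = insert y (univ.image x) := by
    ext a
    simp [Fin.exists_fin_succ, eq_comm]
  exact himage ▸ hK _ (hz x hx')

theorem IsCone.reducedHomology_eq_bot {y : α} (hK : K.IsCone y) : K.reducedHomology R m = ⊥ := by
  rw [reducedHomology_eq_bot_iff]
  intro z hz
  refine ⟨coneMap R y m z, hK.coneMap_mem_chains (cycles_le_chains hz), ?_⟩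
  cases m with
  | zero => exact boundary_coneMap_zero y z
  | succ m => rw [boundary_coneMap_succ, LinearMap.mem_ker.1 hz.2, map_zero, sub_zero]

/-- The union of two complexes. -/
def union (K L : FinComplex α) : FinComplex α where
  faces := K.faces ∪ L.faces
  down_closed s hs t hts := by
    rw [mem_union] at hs ⊢
    exact hs.imp (K.down_closed s · t hts) (L.down_closed s · t hts)

theorem generatedBy_insert (F : Finset α) (S : Finset (Finset α)) :
    generatedBy (insert F S) = (generatedBy S).union (simplex F) :=
  ext_mem fun s => by simp [union, or_comm]

theorem chains_union : (K.union L).chains R m = K.chains R m ⊔ L.chains R m := by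
  rw [chains, chains, chains, ← Finsupp.supported_union]
  simp only [union, mem_union, Set.ofPred_or]

theorem reducedHomology_union_eq_bot (hK : K.reducedHomology R m = ⊥)
    (hL : L.reducedHomology R m = ⊥)
    (hKL : ∀ n, n + 1 = m → (K.inter L).reducedHomology R n = ⊥) :
    (K.union L).reducedHomology R m = ⊥ := by
  simp only [reducedHomology_eq_bot_iff] at hK hL hKL ⊢
  intro z hz
  suffices h : z ∈ K.cycles R m ⊔ L.cycles R m by
    refine sup_le (hK.trans ?_) (hL.trans ?_) h
    · exact boundaries_mono subset_union_left
    · exact boundaries_mono subset_union_right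
  have hz_chain := cycles_le_chains hz
  rw [chains_union] at hz_chain
  cases m with
  | zero => exact hz_chain
  | succ m =>
    obtain ⟨a, ha, b, hb, rfl⟩ := Submodule.mem_sup.1 hz_chain
    have hab : boundary R α m a = -boundary R α m b := by
      rw [eq_neg_iff_add_eq_zero, ← map_add]
      exact hz.2
    have hcycle : boundary R α m a ∈ (K.inter L).cycles R m := by
      have haK := boundary_mem_cycles ha
      have haL : boundary R α m a ∈ L.cycles R m := hab ▸ neg_mem (boundary_mem_cycles hb)
      have hchain : boundary R α m a ∈ (K.inter L).chains R m :=
        chains_inter.ge ⟨cycles_le_chains haK, cycles_le_chains haL⟩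
      cases m with
      | zero => exact hchain
      | succ m => exact ⟨hchain, haK.2⟩
    obtain ⟨c, hc, hca⟩ := hKL m rfl hcycle
    obtain ⟨hcK, hcL⟩ := Submodule.mem_inf.1 (chains_inter.le hc)
    have haK : a - c ∈ K.cycles R (m + 1) :=
      ⟨sub_mem ha hcK, by simp [hca]⟩
    have hbL : b + c ∈ L.cycles R (m + 1) :=
      ⟨add_mem hb hcL, by simp [hca, hab]⟩
    exact Submodule.mem_sup.2 ⟨_, haK, _, hbL, by abel⟩

/-! ### Shellable complexes are sequentially Cohen–Macaulay -/

theorem MeetsInCodimOne.isCone_inter {y : α} (hF : MeetsInCodimOne F S) (hy : y ∈ F)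
    (hyS : F.erase y ∉ (generatedBy S).faces) : ((generatedBy S).inter (simplex F)).IsCone y := by
  intro s hs
  obtain ⟨hsS, hsF⟩ := mem_inter.1 hs
  rw [mem_simplex] at hsF
  obtain ⟨G, hG, hsG⟩ := mem_generatedBy.1 hsS
  obtain ⟨x, -, hxG, hridge⟩ := hF G hG
  rw [← mem_generatedBy] at hridge
  have hxy : x ≠ y := by rintro rfl; exact hyS hridge
  have hxs : x ∉ insert y s := by
    rw [mem_insert, not_or]
    exact ⟨hxy, fun h => hxG (hsG h)⟩
  have hysF : insert y s ⊆ F := insert_subset hy hsF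
  exact mem_inter.2 ⟨down_closed _ _ hridge _ (subset_erase.2 ⟨hysF, hxs⟩), mem_simplex.2 hysF⟩

theorem MeetsInCodimOne.reducedHomology_insert_eq_bot (hF : MeetsInCodimOne F S) (hm : m < #F)
    (hS : (generatedBy S).reducedHomology R m = ⊥) :
    (generatedBy (insert F S)).reducedHomology R m = ⊥ := by
  rw [generatedBy_insert]
  by_cases hbdry : ∀ y ∈ F, F.erase y ∈ (generatedBy S).faces
  · rw [reducedHomology_eq_bot_iff] at hS ⊢
    have hsmall (s : Finset α) (hs : #s ≤ m) :
        s ∈ ((generatedBy S).union (simplex F)).faces ↔ s ∈ (generatedBy S).faces := by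
      refine mem_union.trans (or_iff_left_of_imp fun hsF => ?_)
      obtain ⟨y, hy, hys⟩ := exists_mem_notMem_of_card_lt_card (hs.trans_lt hm)
      exact down_closed _ _ (hbdry y hy) _ (subset_erase.2 ⟨mem_simplex.1 hsF, hys⟩)
    rw [cycles_congr hsmall]
    exact hS.trans (boundaries_mono subset_union_left)
  · push Not at hbdry
    obtain ⟨y, hy, hyS⟩ := hbdry
    exact reducedHomology_union_eq_bot hS (isCone_simplex hy).reducedHomology_eq_bot
      fun _ _ => (hF.isCone_inter hy hyS).reducedHomology_eq_bot

theorem IsShellableFamily.reducedHomology_eq_bot (hS : IsShellableFamily S)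
    (hm : ∀ F ∈ S, m < #F) : (generatedBy S).reducedHomology R m = ⊥ := by
  induction hS with
  | empty => exact reducedHomology_void
  | insert F S _ hF ih =>
    rw [forall_mem_insert] at hm
    exact hF.reducedHomology_insert_eq_bot hm.1 (ih hm.2)

theorem mem_pureSkeleton {d : ℤ} :
    s ∈ (K.pureSkeleton d).faces ↔ ∃ t ∈ K.faces, faceDim t = d ∧ s ⊆ t := by
  simp only [pureSkeleton, mem_generatedBy, mem_filter, and_assoc]

theorem mem_pureSkeleton_iff_of_card_le {n : ℕ} (hs : #s ≤ n) :
    s ∈ (K.pureSkeleton (n - 1)).faces ↔ s ∈ (generatedBy {F ∈ K.facets | n ≤ #F}).faces := by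
  simp only [mem_pureSkeleton, mem_generatedBy, mem_filter, mem_facets, faceDim, sub_left_inj,
    Nat.cast_inj]
  constructor
  · rintro ⟨t, ht, htn, hst⟩
    obtain ⟨F, hF, htF⟩ := exists_isFacet_superset ht
    exact ⟨F, ⟨hF, htn ▸ card_le_card htF⟩, hst.trans htF⟩
  · rintro ⟨F, ⟨hF, hn⟩, hsF⟩
    obtain ⟨t, hst, htF, htn⟩ := exists_subsuperset_card_eq hsF hs hn
    exact ⟨t, K.down_closed _ hF.1 _ htF, htn, hst⟩

theorem card_add_card_le_of_mem_link_pureSkeleton {n : ℕ}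
    (hτ : τ ∈ ((K.pureSkeleton (n - 1)).link σ).faces) : #σ + #τ ≤ n := by
  obtain ⟨hd, hτ⟩ := mem_link.1 hτ
  obtain ⟨t, -, htn, hsub⟩ := mem_pureSkeleton.1 hτ
  have hcard := card_le_card hsub
  rw [card_union_of_disjoint hd] at hcard
  simp only [faceDim] at htn
  omega

theorem IsShellable.isSequentiallyCohenMacaulay (hK : K.IsShellable) :
    K.IsSequentiallyCohenMacaulay R := by
  rw [isShellable_iff_isShellableFamily_facets] at hK
  intro d σ hσ m hm
  obtain ⟨n, rfl⟩ : ∃ n : ℕ, d = n - 1 := by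
    obtain ⟨t, -, rfl, -⟩ := mem_pureSkeleton.1 hσ
    exact ⟨#t, rfl⟩
  have hn : #σ + (m + 1) ≤ n := by
    obtain ⟨τ, hτ, hdim⟩ := exists_card_eq_dim_add_one (K := (K.pureSkeleton (n - 1)).link σ)
      ⟨∅, mem_link.2 ⟨disjoint_empty_right σ, by rwa [union_empty]⟩⟩
    have := card_add_card_le_of_mem_link_pureSkeleton hτ
    omega
  have hlink (s : Finset α) (hs : #s ≤ m + 1) : s ∈ ((K.pureSkeleton (n - 1)).link σ).faces ↔
      s ∈ ((generatedBy {F ∈ K.facets | n ≤ #F}).link σ).faces := by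
    rw [mem_link, mem_link, mem_pureSkeleton_iff_of_card_le ((card_union_le σ s).trans (by omega))]
  rw [reducedHomology_eq_bot_congr hlink, link_generatedBy]
  refine ((hK.filter_le_card K.isAntichain_facets n).image_sdiff σ).reducedHomology_eq_bot
    (forall_mem_image.2 fun F hF => ?_)
  simp only [mem_filter] at hF
  rw [card_sdiff_of_subset hF.2]
  omega

end FinComplex

/-! ### Clutters with simplicial vertices -/

namespace Clutter

open Finset FinComplex

variable {α : Type u} [DecidableEq α] {C D : Clutter α} {e f s σ : Finset α} {v : α} {k : ℤ}

@[simp]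
theorem mem_independenceComplex : s ∈ C.independenceComplex.faces ↔ C.IsIndependent s := by
  simp [independenceComplex, IsIndependent]

theorem isIndependent_erase (he : e ∈ C.circuits) (hv : v ∈ e) : C.IsIndependent (e.erase v) := by
  refine ⟨(erase_subset v e).trans (C.circuit_subset e he), fun f hf hfe => ?_⟩
  obtain rfl : f = e := C.antichain f hf e he (hfe.trans (erase_subset v e))
  exact notMem_erase v f (hfe hv)

theorem exists_minimalSets_subset {S : Finset (Finset α)} (he : e ∈ S) :
    ∃ f ∈ minimalSets S, f ⊆ e := by
  obtain ⟨f, hfe, hf⟩ := S.exists_le_minimal he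
  exact ⟨f, mem_filter.2 ⟨hf.prop, fun e' he' h => hf.eq_of_le he' h⟩, hfe⟩

theorem exists_circuit_of_mem_contract (he : e ∈ (C.contract v).circuits) :
    ∃ f ∈ C.circuits, f.erase v = e :=
  mem_image.1 (mem_filter.1 he).1

theorem isIndependent_contract_iff (hv : v ∈ C.verts) :
    (C.contract v).IsIndependent s ↔ v ∉ s ∧ C.IsIndependent (insert v s) := by
  have hcircuits : (∀ e ∈ (C.contract v).circuits, ¬ e ⊆ s) ↔
      ∀ e ∈ C.circuits, ¬ e ⊆ insert v s := by
    simp only [subset_insert_iff]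
    constructor
    · intro h e he hes
      obtain ⟨f, hf, hfe⟩ := exists_minimalSets_subset (mem_image_of_mem (·.erase v) he)
      exact h f hf (hfe.trans hes)
    · intro h e he
      obtain ⟨f, hf, rfl⟩ := exists_circuit_of_mem_contract he
      exact h f hf
  rw [IsIndependent, IsIndependent, hcircuits, contract, subset_erase, insert_subset_iff]
  tauto

theorem independenceComplex_contract (hv : v ∈ C.verts) :
    (C.contract v).independenceComplex = C.independenceComplex.link {v} :=
  ext_mem fun s => by
    rw [mem_independenceComplex, isIndependent_contract_iff hv, mem_link_singleton,
      mem_independenceComplex]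

theorem exists_isContraction_independenceComplex_eq_link (hσ : σ ⊆ C.verts) :
    ∃ D, C.IsContraction D ∧ D.verts = C.verts \ σ ∧
      D.independenceComplex = C.independenceComplex.link σ := by
  induction σ using Finset.induction_on with
  | empty => exact ⟨C, .refl, (sdiff_empty).symm, (link_empty _).symm⟩
  | insert a σ ha ih =>
    obtain ⟨haC, hσC⟩ := insert_subset_iff.1 hσ
    obtain ⟨D, hD, hDverts, hDlink⟩ := ih hσC
    have haD : a ∈ D.verts := hDverts ▸ mem_sdiff.2 ⟨haC, ha⟩
    refine ⟨D.contract a, .step D a hD haD, ?_, ?_⟩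
    · simp only [contract, hDverts, sdiff_insert]
    · rw [independenceComplex_contract haD, hDlink,
        link_link (disjoint_singleton_right.2 ha), union_comm, ← insert_eq]

theorem IsContraction.trans {E : Clutter α} (hCD : C.IsContraction D) (hDE : D.IsContraction E) :
    C.IsContraction E := by
  induction hDE with
  | refl => exact hCD
  | step E v _ hv ih => exact .step E v ih hv

theorem maxCircuitCard_contract_le (C : Clutter α) (v : α) :
    (C.contract v).maxCircuitCard ≤ C.maxCircuitCard := by
  refine Finset.sup_le fun e he => ?_
  obtain ⟨f, hf, rfl⟩ := exists_circuit_of_mem_contract he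
  exact card_erase_le.trans (le_sup (f := card) hf)

theorem IsContraction.maxCircuitCard_le (h : C.IsContraction D) :
    D.maxCircuitCard ≤ C.maxCircuitCard := by
  induction h with
  | refl => exact le_rfl
  | step D v _ _ ih => exact (D.maxCircuitCard_contract_le v).trans ih

/-- The sets `e \ {v}`, for `e` a circuit containing `v`. -/
def traces (C : Clutter α) (v : α) : Finset (Finset α) :=
  {e ∈ C.circuits | v ∈ e}.image (·.erase v)

theorem forall_mem_traces {p : Finset α → Prop} :
    (∀ σ ∈ C.traces v, p σ) ↔ ∀ e ∈ C.circuits, v ∈ e → p (e.erase v) := by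
  simp only [traces, forall_mem_image, mem_filter, and_imp]

theorem mem_deletionAll_traces (hv : v ∈ C.verts) :
    s ∈ (C.independenceComplex.deletionAll (C.traces v)).faces ↔ C.IsIndependent (insert v s) := by
  simp only [mem_deletionAll, mem_independenceComplex, IsIndependent, forall_mem_traces,
    insert_subset_iff, hv, true_and]
  constructor
  · rintro ⟨⟨hs, hcirc⟩, htrace⟩
    refine ⟨hs, fun e he hes => ?_⟩
    by_cases hve : v ∈ e
    · exact htrace e he hve (subset_insert_iff.1 hes)
    · exact hcirc e he ((subset_insert_iff_of_notMem hve).1 hes)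
  · rintro ⟨hs, hcirc⟩
    exact ⟨⟨hs, fun e he hes => hcirc e he (hes.trans (subset_insert v s))⟩,
      fun e he _ hes => hcirc e he (subset_insert_iff.2 hes)⟩

theorem isDecomposable_deletionAll_traces (hv : v ∈ C.verts)
    (hlink : (C.independenceComplex.link {v}).IsDecomposable k) :
    (C.independenceComplex.deletionAll (C.traces v)).IsDecomposable k := by
  refine IsCone.isDecomposable (v := v) (fun s hs => ?_) ?_
  · rw [mem_deletionAll_traces hv] at hs ⊢
    rwa [insert_idem]
  · convert hlink using 1
    refine ext_mem fun s => ?_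
    rw [mem_link_singleton, mem_link_singleton, mem_deletionAll_traces hv, insert_idem,
      mem_independenceComplex]

namespace IsSimplicialVertex

theorem not_isIndependent (hv : C.IsSimplicialVertex v) (he : e ∈ C.circuits)
    (hf : f ∈ C.circuits) (hef : e ≠ f) (hve : v ∈ e) (hvf : v ∈ f) (hes : e.erase v ⊆ s)
    (hfs : f.erase v ⊆ s) : ¬ C.IsIndependent s := by
  obtain ⟨g, hg, hgsub⟩ := hv.2 e he f hf hef hve hvf
  rw [erase_union_distrib] at hgsub
  exact fun hs => hs.2 g hg (hgsub.trans (union_subset hes hfs))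

theorem isShedBy (hv : C.IsSimplicialVertex v) (he : e ∈ C.circuits) (hve : v ∈ e) :
    C.independenceComplex.IsShedBy v (e.erase v) := by
  refine ⟨mem_independenceComplex.2 (isIndependent_erase he hve), fun τ hτ heτ => ?_⟩
  rw [mem_independenceComplex] at hτ
  have hvτ : v ∉ τ := fun h => hτ.2 e he (insert_erase hve ▸ insert_subset h heτ)
  refine ⟨hvτ, fun x hx => mem_independenceComplex.2
    ⟨(erase_subset x _).trans (insert_subset hv.1 hτ.1), fun f hf hfsub => ?_⟩⟩
  have hfτ : f.erase v ⊆ τ := subset_insert_iff.1 (hfsub.trans (erase_subset x _))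
  by_cases hvf : v ∈ f
  · have hef : e ≠ f := by
      rintro rfl
      exact notMem_erase x _ (hfsub (erase_subset v e hx))
    exact hv.not_isIndependent he hf hef hve hvf heτ hfτ hτ
  · exact hτ.2 f hf (erase_eq_of_notMem hvf ▸ hfτ)

theorem isDecomposable (hv : C.IsSimplicialVertex v) (hk : (C.maxCircuitCard : ℤ) - 2 ≤ k)
    (hlink : (C.independenceComplex.link {v}).IsDecomposable k)
    (hlink_trace : ∀ e ∈ C.circuits, v ∈ e →
      (C.independenceComplex.link (e.erase v)).IsDecomposable k) :
    C.independenceComplex.IsDecomposable k := by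
  refine .of_deletionAll (v := v) (forall_mem_traces.2 fun e he hve => hv.isShedBy he hve) ?_ ?_
    (forall_mem_traces.2 hlink_trace) (isDecomposable_deletionAll_traces hv.1 hlink)
  · refine forall_mem_traces.2 fun e he hve => forall_mem_traces.2 fun f hf hvf hne => ?_
    have hef : e ≠ f := by rintro rfl; exact hne rfl
    rw [mem_independenceComplex]
    exact hv.not_isIndependent he hf hef hve hvf subset_union_left subset_union_right
  · refine forall_mem_traces.2 fun e he hve => ?_
    have hcard : #e ≤ C.maxCircuitCard := le_sup (f := card) he
    rw [faceDim, cast_card_erase_of_mem hve]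
    omega

end IsSimplicialVertex

theorem isDecomposable_independenceComplex (hk : (C.maxCircuitCard : ℤ) - 2 ≤ k)
    (hC : ∀ D : Clutter α, C.IsContraction D → (∃ x, D.IsIndependent {x}) →
      ∃ v, D.IsIndependent {v} ∧ D.IsSimplicialVertex v) :
    C.independenceComplex.IsDecomposable k := by
  induction hn : #C.verts using Nat.strong_induction_on generalizing C with
  | _ n ih =>
    subst hn
    have hlink (σ : Finset α) (hσ : C.IsIndependent σ) (hne : σ.Nonempty) :
        (C.independenceComplex.link σ).IsDecomposable k := by
      obtain ⟨D, hD, hDverts, hDlink⟩ := exists_isContraction_independenceComplex_eq_link hσ.1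
      have hlt : #D.verts < #C.verts := hDverts ▸ card_lt_card (sdiff_ssubset hσ.1 hne)
      have hle := hD.maxCircuitCard_le
      exact hDlink ▸ ih _ hlt (by omega) (fun E hE => hC E (hD.trans hE)) rfl
    by_cases hx : ∃ x, C.IsIndependent {x}
    · obtain ⟨v, hvI, hv⟩ := hC C .refl hx
      refine hv.isDecomposable hk (hlink {v} hvI (singleton_nonempty v)) fun e he hve =>
        hlink _ (isIndependent_erase he hve) ?_
      rw [nonempty_iff_ne_empty, Ne, erase_eq_empty_iff]
      rintro (rfl | rfl)
      · exact notMem_empty v hve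
      · exact hvI.2 _ he subset_rfl
    · refine .of_forall_eq_empty fun s hs => eq_empty_of_forall_notMem fun x hxs => hx ⟨x, ?_⟩
      exact mem_independenceComplex.1
        (C.independenceComplex.down_closed s hs _ (singleton_subset_iff.2 hxs))

end Clutter

theorem mainTheorem4_general {α : Type u} [DecidableEq α] (C : Clutter α)
    (hC : ∀ D : Clutter α, C.IsContraction D → (∃ x, D.IsIndependent {x}) →
      ∃ v, D.IsIndependent {v} ∧ D.IsSimplicialVertex v) :
    C.independenceComplex.IsDecomposable ((C.maxCircuitCard : ℤ) - 2) ∧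
    C.independenceComplex.IsShellable ∧
    ∀ (R : Type w) [CommRing R], C.independenceComplex.IsSequentiallyCohenMacaulay R := by
  have hdecomp : C.independenceComplex.IsDecomposable ((C.maxCircuitCard : ℤ) - 2) :=
    C.isDecomposable_independenceComplex le_rfl hC
  exact ⟨hdecomp, hdecomp.isShellable, fun _ _ => hdecomp.isShellable.isSequentiallyCohenMacaulay⟩

/-- Condition `hC` concerns the contractions `D` of `C` up to singleton circuits: vertices `x` such
that `{x}` is not independent in `D` are disregarded, and if other vertices are left then one of
them has to be simplicial. -/
theorem mainTheorem4 {α : Type u} [DecidableEq α] (C : Clutter α) (k : ℕ)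
    (hk : C.maxCircuitCard = k)
    (hC : ∀ D : Clutter α, C.IsContraction D → (∃ x, D.IsIndependent {x}) →
      ∃ v, D.IsIndependent {v} ∧ D.IsSimplicialVertex v) :
    C.independenceComplex.IsDecomposable ((k : ℤ) - 2) ∧
    C.independenceComplex.IsShellable ∧
    (∀ (F : Type w) [Field F], C.independenceComplex.IsSequentiallyCohenMacaulay F) ∧
    C.independenceComplex.IsSequentiallyCohenMacaulay ℤ := by
  obtain ⟨hdecomp, hshell, hCM⟩ := mainTheorem4_general C hC
  exact ⟨hk ▸ hdecomp, hshell, fun F _ => hCM F, (mainTheorem4_general C hC).2.2 ℤ⟩
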